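/- Let $n\ge 0$ and let $d_1,\dots,d_n$ be integers, each larger than one, and let $D=[d_1]\times\dots\times[d_n]$. A (complex) rank-one tensor is an element $T\in\mathbb{C}^D$ of the form $T=\theta_1\otimes\dots\otimes\theta_n$ with $\theta_j\in\mathbb{C}^{d_j}$, i.e. $T_{i_1,\dots,i_n}=\theta_{1,i_1}\cdots\theta_{n,i_n}$ (zero vectors $\theta_j$ are allowed). For $E\subseteq D$, a partial tensor $T_E\in\mathbb{C}^E$ is completable if it is the restriction to $E$ of a rank-one tensor. An entry $i\in D$ is finitely completable from $T_E$ if the set $\{T_i : T \text{ a rank-one tensor with } T|_E=T_E\}$ is finite. Then there is a matroid on the ground set $D$, with closure operator $\operatorname{cl}:2^D\to 2^D$, having the following property. For every $E\subseteq D$ and every generic completable partial tensor $T_E\in\mathbb{C}^E$, the set $\operatorname{cl}(E)$ consists exactly of the entries $i\in D$ that are finitely completable from $T_E$. Here "generic" means: for every $E$ there is a Zariski-dense, relatively Zariski-open subset $U_E$ of the set of completable partial tensors in $\mathbb{C}^E$ such that the assertion holds for all $T_E\in U_E$. -/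

import Mathlib

namespace RankOneTensor

/-- The index set `D = [d₁] × ⋯ × [dₙ]` of the entries of a tensor. -/
abbrev Index {n : ℕ} (d : Fin n → ℕ) : Type := (j : Fin n) → Fin (d j)

variable {n : ℕ} {d : Fin n → ℕ}

/-- The parametrization `(θ₁, …, θₙ) ↦ θ₁ ⊗ ⋯ ⊗ θₙ`, whose `(i₁, …, iₙ)` entry is
`θ₁ i₁ ⋯ θₙ iₙ`. -/
def tensorOfParams (θ : (j : Fin n) → Fin (d j) → ℂ) : Index d → ℂ :=
  fun i => ∏ j, θ j (i j)

/-- The set of complex rank-one tensors: the image of the parametrization. -/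
def rankOneTensors (d : Fin n → ℕ) : Set (Index d → ℂ) :=
  Set.range (tensorOfParams (d := d))

/-- The set of all rank-one completions of the partial tensor `T_E`: the rank-one tensors whose
restriction to `E` is `T_E`. -/
def rankOneCompletions {E : Set (Index d)} (TE : E → ℂ) : Set (Index d → ℂ) :=
  {T | T ∈ rankOneTensors d ∧ E.domRestrict T = TE}

/-- The set of completable partial tensors with index set `E`: those that are the restriction to
`E` of some rank-one tensor. -/
def completable (E : Set (Index d)) : Set (E → ℂ) :=
  {TE | (rankOneCompletions TE).Nonempty}

/-- The entry at position `i` is finitely completable from `T_E`: it takes only finitely many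
values on the rank-one completions of `T_E`. -/
def FinitelyCompletable {E : Set (Index d)} (TE : E → ℂ) (i : Index d) : Prop :=
  ((fun T : Index d → ℂ => T i) '' rankOneCompletions TE).Finite

/-- `P` holds for generic points of `X ⊆ ℂ^σ`: it holds at all points of a relatively Zariski
open subset `X \ V(I)` of `X` which is Zariski dense in `X`. -/
def HoldsGenericallyOn {σ : Type} (X : Set (σ → ℂ)) (P : (σ → ℂ) → Prop) : Prop :=
  ∃ I : Ideal (MvPolynomial σ ℂ),
    X ⊆ MvPolynomial.zeroLocus ℂ
      (MvPolynomial.vanishingIdeal ℂ (X \ MvPolynomial.zeroLocus ℂ I)) ∧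
    ∀ x ∈ X \ MvPolynomial.zeroLocus ℂ I, P x

end RankOneTensor

/-! Each entry of a rank-one tensor is a monomial in the parameters, with a 0/1 exponent vector. The
matroid is the linear matroid over ℚ of these vectors, and "generic" means that no entry of `TE` is
zero. If the vector of `i` lies in the span of those of `E`, clearing denominators makes a nonzero
power of `T i` a Laurent monomial in `TE`, so only finitely many values occur
(`finitelyCompletable_of_mem_span`). Otherwise a linear functional separates them and gives a torus
action fixing `TE` but moving `T i` (`not_finitelyCompletable_of_notMem_span`). -/

namespace Matroid

/-- The linear matroid on a finite type represented by a family `v` of vectors. -/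
theorem exists_linear {α K V : Type*} [Finite α] [DivisionRing K] [AddCommGroup V] [Module K V]
    [Module.Finite K V] (v : α → V) :
    ∃ M : Matroid α, M.E = Set.univ ∧
      ∀ E : Set α, M.closure E = {i | v i ∈ Submodule.span K (v '' E)} := by
  classical
  have hcard : ∀ {I : Set α}, LinearIndepOn K v I →
      Module.finrank K (Submodule.span K (v '' I)) = I.ncard := by
    intro I hI
    have := Fintype.ofFinite I
    rw [Set.image_eq_range, finrank_span_eq_card hI, ← Nat.card_eq_fintype_card,
      Nat.card_coe_set_eq]
  let M₀ : IndepMatroid α := IndepMatroid.ofFinite (E := Set.univ) Set.finite_univ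
    (fun I => LinearIndepOn K v I) (linearIndepOn_empty K v) (fun I J hJ hIJ => hJ.mono hIJ)
    (by
      intro I J hI hJ hIJ
      -- If no element of `J` extends `I`, then `J` lies in the span of `I`, against the dimension
      -- count.
      by_contra! hno
      have hle : Submodule.span K (v '' J) ≤ Submodule.span K (v '' I) := by
        rw [Submodule.span_le]
        rintro _ ⟨e, he, rfl⟩
        by_cases heI : e ∈ I
        · exact Submodule.subset_span ⟨e, heI, rfl⟩
        · by_contra hspan
          exact hno e he heI ((linearIndepOn_insert heI).2 ⟨hI, hspan⟩)
      have := Submodule.finrank_mono hle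
      rw [hcard hI, hcard hJ] at this
      omega)
    (fun I _ => Set.subset_univ I)
  have hindep : ∀ I, M₀.matroid.Indep I ↔ LinearIndepOn K v I := fun I => Iff.rfl
  refine ⟨M₀.matroid, rfl, fun E => ?_⟩
  obtain ⟨I, hI⟩ := M₀.matroid.exists_isBasis E (Set.subset_univ E)
  have hIv := (hindep I).1 hI.indep
  have hmem : ∀ e, e ∈ M₀.matroid.closure I ↔ v e ∈ Submodule.span K (v '' I) := by
    intro e
    rw [hI.indep.mem_closure_iff', hindep]
    by_cases he : e ∈ I
    · have hv : v e ∈ Submodule.span K (v '' I) := Submodule.subset_span ⟨e, he, rfl⟩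
      simp only [he, hv, implies_true, and_true, iff_true]
      exact Set.mem_univ e
    · rw [linearIndepOn_insert he]
      simp only [he, hIv, true_and, imp_false, not_not]
      exact and_iff_right (Set.mem_univ e)
  have hspan : Submodule.span K (v '' I) = Submodule.span K (v '' E) := by
    refine le_antisymm (Submodule.span_mono (Set.image_mono hI.subset)) (Submodule.span_le.2 ?_)
    rintro _ ⟨e, he, rfl⟩
    refine (hmem e).1 ?_
    rw [hI.closure_eq_closure]
    exact M₀.matroid.subset_closure E (Set.subset_univ E) he
  ext e
  rw [← hI.closure_eq_closure, hmem, hspan]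
  rfl

end Matroid

/-- Denominators of a finite family of rationals can be cleared. -/
theorem Rat.exists_int_mul_eq {ι : Type*} [Finite ι] (c : ι → ℚ) :
    ∃ b : ℤ, b ≠ 0 ∧ ∃ z : ι → ℤ, ∀ i, (z i : ℚ) = b * c i := by
  obtain ⟨b, hb⟩ := IsLocalization.exist_integer_multiples_of_finite (nonZeroDivisors ℤ) c
  choose z hz using hb
  exact ⟨b, nonZeroDivisors.coe_ne_zero b, z, fun i => by simpa using hz i⟩

/-- A nonzero element raised to a finite sum of integers. -/
theorem Finset.prod_zpow_eq_zpow_sum₀ {ι K : Type*} [Field K] {a : K} (ha : a ≠ 0) (s : Finset ι)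
    (f : ι → ℤ) : ∏ i ∈ s, a ^ f i = a ^ ∑ i ∈ s, f i := by
  classical
  induction s using Finset.induction_on with
  | empty => simp
  | insert i s hi ih => rw [Finset.prod_insert hi, Finset.sum_insert hi, zpow_add₀ ha, ih]

theorem Set.finite_setOf_zpow_eq {K : Type*} [Field K] {b : ℤ} (hb : b ≠ 0) (C : K) :
    {z : K | z ^ b = C}.Finite := by
  classical
  have key : ∀ (m : ℕ), 0 < m → ∀ C : K, {z : K | z ^ m = C}.Finite := fun m hm C =>
    (Polynomial.nthRoots m C).toFinset.finite_toSet.subset fun z hz => by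
      simpa [Polynomial.mem_nthRoots hm] using! hz
  rcases Int.natAbs_eq b with h | h
  · rw [h]
    simp only [zpow_natCast]
    exact key b.natAbs (Int.natAbs_pos.2 hb) C
  · refine (key b.natAbs (Int.natAbs_pos.2 hb) C⁻¹).subset fun z hz => ?_
    change z ^ b = C at hz
    rw [h, zpow_neg, zpow_natCast] at hz
    change z ^ b.natAbs = C⁻¹
    rw [← hz, inv_inv]

namespace RankOneTensor

variable {n : ℕ} {d : Fin n → ℕ}

/-- The exponent vector of the monomial `θ₁ i₁ ⋯ θₙ iₙ`. -/
def exponent (R : Type*) [Zero R] [One R] (i : Index d) (p : (j : Fin n) × Fin (d j)) : R :=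
  if i p.1 = p.2 then 1 else 0

theorem sum_exponent_mul {R : Type*} [CommSemiring R] (i : Index d)
    (w : (j : Fin n) × Fin (d j) → R) :
    ∑ p, exponent R i p * w p = ∑ j, w ⟨j, i j⟩ := by
  rw [Fintype.sum_sigma]
  simp [exponent]

theorem tensorOfParams_eq_prod_zpow (θ : (j : Fin n) → Fin (d j) → ℂ) (i : Index d) :
    tensorOfParams θ i = ∏ p : (j : Fin n) × Fin (d j), θ p.1 p.2 ^ exponent ℤ i p := by
  rw [Fintype.prod_sigma]
  refine Finset.prod_congr rfl fun j _ => ?_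
  rw [Finset.prod_eq_single (i j)]
  · simp [exponent]
  · intro k _ hk
    simp [exponent, hk.symm]
  · simp

/-- The nonvanishing entries of a rank-one tensor come from nowhere vanishing parameters. -/
theorem exists_params_ne_zero {T : Index d → ℂ} (hT : T ∈ rankOneTensors d) :
    ∃ θ : (j : Fin n) → Fin (d j) → ℂ, (∀ j k, θ j k ≠ 0) ∧
      ∀ i, T i ≠ 0 → tensorOfParams θ i = T i := by
  classical
  obtain ⟨θ, rfl⟩ := hT
  -- A nonzero entry involves no zero parameter, so replacing zeros by 1 leaves it unchanged.
  refine ⟨fun j k => if θ j k = 0 then 1 else θ j k, fun j k => ?_, fun i hi => ?_⟩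
  · dsimp only
    split_ifs with h
    · exact one_ne_zero
    · exact h
  · refine Finset.prod_congr rfl fun j _ => if_neg ?_
    exact Finset.prod_ne_zero_iff.1 hi j (Finset.mem_univ j)

theorem finitelyCompletable_of_mem_span {E : Set (Index d)} {TE : E → ℂ} (hTE : ∀ e, TE e ≠ 0)
    {i : Index d} (hi : exponent ℚ i ∈ Submodule.span ℚ (exponent ℚ '' E)) :
    FinitelyCompletable TE i := by
  classical
  rw [Set.image_eq_range, Submodule.mem_span_range_iff_exists_fun] at hi
  obtain ⟨c, hc⟩ := hi
  obtain ⟨b, hb, z, hz⟩ := Rat.exists_int_mul_eq c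
  have hrel : ∀ p, ∑ e : E, exponent ℤ (e : Index d) p * z e = exponent ℤ i p * b := by
    intro p
    have hcast : ∀ i : Index d, ((exponent ℤ i p : ℤ) : ℚ) = exponent ℚ i p := fun i => by
      simp [exponent]
    have := congrFun hc p
    simp only [Finset.sum_apply, Pi.smul_apply, smul_eq_mul] at this
    rw [← Int.cast_inj (α := ℚ)]
    push_cast
    simp only [hz, hcast, ← this, Finset.sum_mul]
    exact Finset.sum_congr rfl fun e _ => by ring
  -- Only entries in `E` are known to be nonzero. A completion may vanish at `i`, where the monomial
  -- relation can fail, so 0 is allowed separately.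
  refine ((Set.finite_singleton 0).union
    (Set.finite_setOf_zpow_eq hb (∏ e : E, TE e ^ z e))).subset ?_
  rintro _ ⟨T, ⟨hT, hTE'⟩, rfl⟩
  by_cases hTi : T i = 0
  · exact Or.inl hTi
  right
  obtain ⟨θ, hθ, hθT⟩ := exists_params_ne_zero hT
  have hE : ∀ e : E, TE e = tensorOfParams θ e := fun e => by
    have h : T e = TE e := congrFun hTE' e
    rw [hθT e (h ▸ hTE e), h]
  change T i ^ b = _
  simp only [hE, ← hθT i hTi, tensorOfParams_eq_prod_zpow, ← Finset.prod_zpow, ← zpow_mul]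
  rw [Finset.prod_comm]
  refine Finset.prod_congr rfl fun p _ => ?_
  rw [← hrel p, Finset.prod_zpow_eq_zpow_sum₀ (hθ p.1 p.2)]

theorem not_finitelyCompletable_of_notMem_span {E : Set (Index d)} {TE : E → ℂ}
    (hTE : ∀ e, TE e ≠ 0) (hcomp : TE ∈ completable E) {i : Index d}
    (hi : exponent ℚ i ∉ Submodule.span ℚ (exponent ℚ '' E)) :
    ¬ FinitelyCompletable TE i := by
  classical
  -- The values of `f` on the standard basis, scaled to integers `w`, are the weights of a
  -- one-parameter torus.
  obtain ⟨f, hfi, hfE⟩ := Submodule.exists_le_ker_of_notMem hi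
  obtain ⟨b, hb, w, hw⟩ := Rat.exists_int_mul_eq
    fun p : (j : Fin n) × Fin (d j) => f (Pi.single p 1)
  have hval : ∀ i : Index d, ((∑ j, w ⟨j, i j⟩ : ℤ) : ℚ) = b * f (exponent ℚ i) := by
    intro i
    have h : exponent ℚ i = ∑ p, exponent ℚ i p • (Pi.single p 1 : _ → ℚ) := pi_eq_sum_univ' _
    conv_rhs => rw [h, map_sum]
    simp only [map_smul, smul_eq_mul]
    rw [sum_exponent_mul i fun p => f (Pi.single p 1), Finset.mul_sum]
    push_cast
    exact Finset.sum_congr rfl fun j _ => hw _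
  have hwE : ∀ e ∈ E, ∑ j, w ⟨j, e j⟩ = 0 := fun e he => by
    have h : f (exponent ℚ e) = 0 := hfE (Submodule.subset_span ⟨e, he, rfl⟩)
    have := hval e
    rw [h, mul_zero] at this
    exact_mod_cast this
  have hwi : ∑ j, w ⟨j, i j⟩ ≠ 0 := fun h => by
    have := hval i
    rw [h, Int.cast_zero, eq_comm, mul_eq_zero] at this
    exact this.elim (by exact_mod_cast hb) hfi
  obtain ⟨T, hT, hTE'⟩ := hcomp
  obtain ⟨θ, hθ, hθT⟩ := exists_params_ne_zero hT
  have hE : ∀ e : E, tensorOfParams θ e = TE e := fun e => by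
    have h : T e = TE e := congrFun hTE' e
    rw [hθT e (h ▸ hTE e), h]
  -- The torus element `2 ^ m` scales each entry by its total weight: zero on `E`, nonzero at `i`.
  -- As 2 is not a root of unity, different `m` give different values at `i`.
  let θ' : ℕ → (j : Fin n) → Fin (d j) → ℂ := fun m j k => θ j k * ((2 : ℂ) ^ m) ^ w ⟨j, k⟩
  have hθ' : ∀ m i, tensorOfParams (θ' m) i =
      tensorOfParams θ i * ((2 : ℂ) ^ m) ^ (∑ j, w ⟨j, i j⟩) := by
    intro m i
    have h2 : ((2 : ℂ) ^ m) ≠ 0 := pow_ne_zero m two_ne_zero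
    simp only [tensorOfParams, θ', Finset.prod_mul_distrib,
      Finset.prod_zpow_eq_zpow_sum₀ h2]
  refine Set.infinite_of_injective_forall_mem (f := fun m => tensorOfParams (θ' m) i) ?_
    fun m => ⟨_, ⟨⟨θ' m, rfl⟩, ?_⟩, rfl⟩
  · intro m m' h
    have hne : tensorOfParams θ i ≠ 0 := Finset.prod_ne_zero_iff.2 fun j _ => hθ _ _
    simp only [hθ'] at h
    have h := mul_left_cancel₀ hne h
    rw [← zpow_natCast, ← zpow_natCast, ← zpow_mul, ← zpow_mul] at h
    have h' : (2 : ℝ) ^ ((m : ℤ) * ∑ j, w ⟨j, i j⟩) = 2 ^ ((m' : ℤ) * ∑ j, w ⟨j, i j⟩) := by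
      rw [← Complex.ofReal_inj]
      push_cast
      exact h
    have := zpow_right_injective₀ (by norm_num) (by norm_num) h'
    exact_mod_cast mul_right_cancel₀ hwi this
  · ext e
    change tensorOfParams (θ' m) e = TE e
    rw [hθ', hwE e e.2, zpow_zero, mul_one, hE]

open Filter Topology in
/-- A polynomial vanishing at the completable partial tensors with no zero entry vanishes at all
completable partial tensors. -/
theorem completable_subset_zeroLocus_vanishingIdeal (E : Set (Index d)) :
    completable E ⊆ MvPolynomial.zeroLocus ℂ
      (MvPolynomial.vanishingIdeal ℂ {TE ∈ completable E | ∀ e, TE e ≠ 0}) := by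
  rintro TE ⟨_, ⟨θ, rfl⟩, rfl⟩
  rw [MvPolynomial.mem_zeroLocus_iff]
  intro p hp
  rw [MvPolynomial.mem_vanishingIdeal_iff] at hp
  -- Shifting all parameters by a small `t ≠ 0` makes them nonzero, so `p` vanishes at `T t`;
  -- continuity carries this to `t = 0`.
  let T : ℂ → E → ℂ := fun t e => tensorOfParams (fun j k => θ j k + t) e
  have hcont : Continuous fun t => MvPolynomial.aeval (T t) p := by
    have : Continuous T := by
      unfold T tensorOfParams
      fun_prop
    simpa [MvPolynomial.aeval_eq_eval] using! (MvPolynomial.continuous_eval p).comp this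
  have hev : ∀ᶠ t : ℂ in 𝓝[≠] 0, MvPolynomial.aeval (T t) p = 0 := by
    have hne : ∀ᶠ t : ℂ in 𝓝[≠] 0, ∀ j k, θ j k + t ≠ 0 := by
      refine eventually_all.2 fun j => eventually_all.2 fun k => ?_
      by_cases h : θ j k = 0
      · filter_upwards [self_mem_nhdsWithin] with t ht
        simpa [h] using! ht
      · have : ∀ᶠ t : ℂ in 𝓝 0, θ j k + t ≠ 0 :=
          (continuous_const.add continuous_id).continuousAt.eventually_ne (by simpa using h)
        exact this.filter_mono nhdsWithin_le_nhds
    filter_upwards [hne] with t ht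
    exact hp _ ⟨⟨_, ⟨_, rfl⟩, rfl⟩, fun e => Finset.prod_ne_zero_iff.2 fun j _ => ht _ _⟩
  have h0 := tendsto_nhds_unique ((hcont.tendsto 0).mono_left nhdsWithin_le_nhds)
    (tendsto_const_nhds.congr' (hev.mono fun t ht => ht.symm))
  simpa [T] using! h0

end RankOneTensor

theorem mainTheorem5 (n : ℕ) (d : Fin n → ℕ) (hd : ∀ j, 1 < d j) :
    ∃ M : Matroid (RankOneTensor.Index d), M.E = Set.univ ∧
      ∀ E : Set (RankOneTensor.Index d),
        RankOneTensor.HoldsGenericallyOn (RankOneTensor.completable E)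
          (fun TE => M.closure E = {i | RankOneTensor.FinitelyCompletable TE i}) := by
  classical
  obtain ⟨M, hME, hM⟩ := Matroid.exists_linear (K := ℚ) (RankOneTensor.exponent (d := d) ℚ)
  -- The excluded locus is the union of the coordinate hyperplanes of `E`.
  refine ⟨M, hME, fun E => ⟨Ideal.span {∏ e : E, (MvPolynomial.X e : MvPolynomial E ℂ)}, ?_⟩⟩
  have hset : RankOneTensor.completable E \
      MvPolynomial.zeroLocus ℂ (Ideal.span {∏ e : E, (MvPolynomial.X e : MvPolynomial E ℂ)}) =
      {TE ∈ RankOneTensor.completable E | ∀ e, TE e ≠ 0} := by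
    ext TE
    simp [MvPolynomial.zeroLocus_span, Finset.prod_eq_zero_iff]
  rw [hset]
  refine ⟨RankOneTensor.completable_subset_zeroLocus_vanishingIdeal E, fun TE hTE => ?_⟩
  ext i
  rw [hM]
  refine ⟨RankOneTensor.finitelyCompletable_of_mem_span hTE.2, fun h => ?_⟩
  by_contra hi
  exact RankOneTensor.not_finitelyCompletable_of_notMem_span hTE.2 hTE.1 hi h
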